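/- Let $d\ge 0$ be an integer and let $(C_1,\dots,C_{d+1})$ be a convex partition of $\mathbb{R}^d$ into convex cones with apex at the origin; that is, each $C_i$ is a closed convex cone with apex at the origin, $\bigcup_{i=1}^{d+1} C_i=\mathbb{R}^d$, and the interiors of $C_1,\dots,C_{d+1}$ are pairwise disjoint. Assume that the partition is nondegenerate: every $C_i$ has nonempty interior, and the origin is the only common apex of the cones, i.e. no line through the origin is contained in all of $C_1,\dots,C_{d+1}$. Let $\alpha_1,\dots,\alpha_{d+1}$ be positive real numbers with $\sum_{i=1}^{d+1}\alpha_i=1$, and let $\mu_1,\dots,\mu_d$ be probability measures on $\mathbb{R}^d$ that are absolutely continuous with respect to Lebesgue measure. Then there exists a vector $x\in\mathbb{R}^d$ (depending only on the $C_i$, the $\alpha_i$ and $\mu_1,\dots,\mu_d$) such that for every probability measure $\mu_{d+1}$ on $\mathbb{R}^d$ that is absolutely continuous with respect to Lebesgue measure there is a permutation $\pi$ of $\{1,\dots,d+1\}$ with $$\mu_{\pi(i)}(x+C_i)\ \ge\ \alpha_i\qquad\text{for all } i\in\{1,\dots,d+1\}.$$ In particular, for any $d+1$ absolutely continuous probability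 measures $\mu_1,\dots,\mu_{d+1}$ on $\mathbb{R}^d$ there are a vector $x$ and a permutation $\pi$ with this property. -/

import Mathlib

open MeasureTheory
open scoped Pointwise

/-- A convex partition of a real vector space: a family of closed convex sets that covers the whole
space and whose interiors are pairwise disjoint. -/
structure IsConvexPartition {ι E : Type*} [AddCommGroup E] [Module ℝ E] [TopologicalSpace E]
    (C : ι → Set E) : Prop where
  isClosed : ∀ i, IsClosed (C i)
  convex : ∀ i, Convex ℝ (C i)
  iUnion_eq : ⋃ i, C i = Set.univ
  disjoint_interior : Pairwise fun i j => Disjoint (interior (C i)) (interior (C j))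

/-- A convex partition into convex cones with apex at the origin (`ConvexCone` is closed under
addition and under multiplication by positive scalars) that is nondegenerate: every cone has
nonempty interior, and the origin is the only common apex, i.e. no line through the origin lies in
all the cones. -/
structure IsConicalPartition {ι E : Type*} [AddCommGroup E] [Module ℝ E] [TopologicalSpace E]
    (C : ι → ConvexCone ℝ E) : Prop where
  isConvexPartition : IsConvexPartition fun i => (C i : Set E)
  nonempty_interior : ∀ i, (interior (C i : Set E)).Nonempty
  eq_zero_of_common_line : ∀ v : E, (∀ i, v ∈ C i ∧ -v ∈ C i) → v = 0

/-!
Write `E` for the Euclidean space, of dimension `d`, and `h j i x` for `μ j (x + C i)`. It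
suffices to find `x` such that for *every* index `i₀` the `d` given measures can be matched
injectively with the cones other than `C i₀` so that matched pairs satisfy `α i ≤ h j i x`: the
numbers `ν (x + C i)` sum to at least `1`, so `ν` accepts some cone `C i₀`
(`exists_le_measureReal_vadd`), and the matching for that `i₀` completes the permutation.

**Matching.** Let `g x j i` be the positive part of `h j i x - α i + ε`, normalised so that each
row sums to `1`. If every column sum `Γ x i = ∑ j, g x j i` is less than `1`, then `k` rows meet
at least `k + 1` columns, and Hall's theorem provides the matchings avoiding a given `i₀`
(`exists_injective_avoiding_of_sum_lt_one`). Points `x` obtained in this way for `ε → 0` stay in a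
fixed compact set, and a limit point works for `ε = 0` (`exists_translation`).

**Linear algebra of the partition.** Separate the cones by functionals `l i j = -l j i` that are
nonnegative on `C i` and positive on its interior for `i ≠ j`, and let `s i = ∑ j, l i j`. Then
`∑ i, s i = 0`, each `s i` is nonnegative on `C i`, and nondegeneracy makes `x ↦ (s i x)`
injective (`IsConicalPartition.exists_functionals`); as there are `d + 1` cones, it is an
isomorphism of `E` onto the hyperplane of vectors with coordinate sum `0`.

**A zero of a vector field.** If `Γ x i > 0`, then `x + C i` has mass bounded below for some
`μ j`. As it lies in the half-space `s i x ≤ s i y`, this bounds `s i x` above by a constant `M`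
(`exists_bound_of_le_measureReal_vadd`). Consequently the field with components
`d / (d + 1) - Γ x i + η * s i x`, transported to `E` by the adjoint of `s`, points outwards far
from the origin, and so it vanishes somewhere. At a zero `Γ x i = d / (d + 1) + η * s i x`; the
correction `η * s i x` has order `√η`, so for `d ≥ 1` all `Γ x i` lie strictly between `0` and
`1`, and positivity yields `s i x ≤ M` for every `i`, which confines `x` to a compact set
(`exists_forall_lt_one_and_le`).

**The topological input.** That a continuous outward pointing field has a zero
(`exists_eq_zero_of_inner_pos`) is a form of Brouwer's theorem. It reduces to fields `x + g x`
with `g` of class `C¹` and compactly supported in a ball `B`. For small `t ≥ 0` the map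
`x ↦ x + t • g x` permutes `B`, so `∫ x in B, det (1 + t Dg) * q (x + t • g x) = ∫ x in B, q x`.
When `q` is polynomial, the left side is a polynomial in `t`, so the identity persists at `t = 1`.
If `x + g x` had no zero, taking `q y = (1 - c ‖y‖ ^ 2) ^ k`, which concentrates at the origin as
`k` grows, would give a contradiction (`exists_add_eq_zero_of_contDiff`).
-/

/-! ### Zeros of outward pointing vector fields -/

section Brouwer

variable {E : Type*} [NormedAddCommGroup E] [InnerProductSpace ℝ E] [FiniteDimensional ℝ E]

/-- The determinant of `1 + t A(x)` is a polynomial in `t` whose coefficients are continuous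
functions of `x`. -/
theorem exists_polynomial_eval_eq_det {X : Type*} [TopologicalSpace X] {A : X → E →L[ℝ] E}
    (hA : Continuous A) :
    ∃ p : Polynomial C(X, ℝ), ∀ x t,
      (ContinuousLinearMap.id ℝ E + t • A x).det =
        (p.map (ContinuousMap.evalAlgHom ℝ ℝ x : C(X, ℝ) →+* ℝ)).eval t := by
  set b := Module.finBasis ℝ E
  have hc : ∀ i j, Continuous fun x => LinearMap.toMatrix b b (A x : E →ₗ[ℝ] E) i j := by
    intro i j
    simp only [LinearMap.toMatrix_apply]
    have h1 : Continuous fun x => A x (b j) := by fun_prop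
    exact (LinearMap.continuous_of_finiteDimensional (b.coord i)).comp h1
  let N : Matrix (Fin (Module.finrank ℝ E)) (Fin (Module.finrank ℝ E)) (Polynomial C(X, ℝ)) :=
    1 + Matrix.of fun i j => Polynomial.X * Polynomial.C ⟨_, hc i j⟩
  refine ⟨N.det, fun x t => ?_⟩
  have h := (((Polynomial.evalRingHom t).comp
    (Polynomial.mapRingHom (ContinuousMap.evalAlgHom ℝ ℝ x : C(X, ℝ) →+* ℝ))).map_det N)
  simp only [RingHom.comp_apply, Polynomial.coe_mapRingHom, Polynomial.coe_evalRingHom] at h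
  rw [h, ContinuousLinearMap.det, ← LinearMap.det_toMatrix b]
  congr 1
  ext i j
  simp [N, Matrix.one_apply]
  split_ifs <;> simp [mul_comm]

/-- Integrating out `x` in a polynomial in `t` with coefficients continuous in `x` leaves a
polynomial in `t`. -/
theorem exists_polynomial_eval_eq_integral {X : Type*} [TopologicalSpace X] [MeasurableSpace X]
    [OpensMeasurableSpace X] [T2Space X] (ν : Measure X) [IsFiniteMeasureOnCompacts ν] {K : Set X}
    (hK : IsCompact K) (p : Polynomial C(X, ℝ)) :
    ∃ P : Polynomial ℝ, ∀ t,
      ∫ x in K, (p.map (ContinuousMap.evalAlgHom ℝ ℝ x : C(X, ℝ) →+* ℝ)).eval t ∂ν = P.eval t := by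
  refine ⟨∑ k ∈ Finset.range (p.natDegree + 1),
    Polynomial.C (∫ x in K, p.coeff k x ∂ν) * Polynomial.X ^ k, fun t => ?_⟩
  simp only [Polynomial.eval_map, Polynomial.eval₂_eq_sum_range, Polynomial.eval_finsetSum,
    Polynomial.eval_mul, Polynomial.eval_C, Polynomial.eval_pow, Polynomial.eval_X]
  rw [integral_finsetSum]
  · refine Finset.sum_congr rfl fun k _ => ?_
    rw [integral_mul_const]
    rfl
  · intro k _
    exact (((p.coeff k).continuous.continuousOn.integrableOn_compact hK).mul_const _)

/-- The determinant of `1 + s A` does not vanish for `s` in `[0, 1]` and equals `1` at `s = 0`. -/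
theorem det_id_add_pos {A : E →L[ℝ] E} (hA : ‖A‖ < 1) :
    0 < (ContinuousLinearMap.id ℝ E + A).det := by
  have hne : ∀ s ∈ Set.Icc (0 : ℝ) 1, (ContinuousLinearMap.id ℝ E + s • A).det ≠ 0 := by
    intro s hs h0
    have hs' : ‖-(s • A)‖ < 1 := by
      rw [norm_neg, norm_smul, Real.norm_of_nonneg hs.1]
      nlinarith [norm_nonneg A, hs.2]
    have hu : IsUnit (1 - (-(s • A)) : E →L[ℝ] E) := (Units.oneSub _ hs').isUnit
    rw [sub_neg_eq_add] at hu
    have h2 : IsUnit ((1 + s • A : E →L[ℝ] E) : E →ₗ[ℝ] E) :=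
      hu.map (ContinuousLinearMap.toLinearMapRingHom : (E →L[ℝ] E) →+* (E →ₗ[ℝ] E))
    exact ((LinearMap.isUnit_iff_isUnit_det _).1 h2).ne_zero h0
  have hcont : Continuous fun s : ℝ => (ContinuousLinearMap.id ℝ E + s • A).det := by
    have : Continuous fun s : ℝ => ContinuousLinearMap.id ℝ E + s • A := by fun_prop
    exact ContinuousLinearMap.continuous_det.comp this
  by_contra! hle
  have := isPreconnected_Icc.intermediate_value (Set.right_mem_Icc.2 zero_le_one)
    (Set.left_mem_Icc.2 (zero_le_one (α := ℝ))) hcont.continuousOn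
  obtain ⟨s, hs, h0⟩ := this (a := 0) ⟨by simpa using hle, by simp [ContinuousLinearMap.det]⟩
  exact hne s hs h0

/-- For small `t` the map `x ↦ x + t • g x` permutes the ball outside of which `g` vanishes, and
it has positive Jacobian, so this is the change of variables formula. -/
theorem integral_det_mul_comp_eq [MeasurableSpace E] [BorelSpace E] {g : E → E}
    (hg : ContDiff ℝ 1 g) {R : ℝ} (hR : ∀ x, R < ‖x‖ → g x = 0) {C : NNReal}
    (hC : LipschitzWith C g) {t : ℝ} (ht0 : 0 ≤ t) (ht : t * C < 1) (q : E → ℝ) :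
    ∫ x in Metric.closedBall (0 : E) R,
      (ContinuousLinearMap.id ℝ E + t • fderiv ℝ g x).det * q (x + t • g x) =
      ∫ x in Metric.closedBall (0 : E) R, q x := by
  set f : E → E := fun x => x + t • g x with hf
  have hlip : ∀ x y, ‖t • g x - t • g y‖ ≤ t * C * ‖x - y‖ := by
    intro x y
    rw [← smul_sub, norm_smul, Real.norm_of_nonneg ht0, mul_assoc]
    exact mul_le_mul_of_nonneg_left (by simpa [dist_eq_norm] using hC.dist_le_mul x y) ht0
  have hinj : Function.Injective f := by
    intro x y hxy
    have h1 : x - y = -(t • g x - t • g y) := by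
      have : x + t • g x = y + t • g y := hxy
      rw [← sub_eq_zero] at this ⊢
      rw [← this]
      abel
    have h2 := hlip x y
    have h3 : ‖x - y‖ = ‖t • g x - t • g y‖ := by rw [h1, norm_neg]
    have h4 : ‖x - y‖ ≤ 0 := by
      by_contra! h
      nlinarith
    exact sub_eq_zero.1 (norm_le_zero_iff.1 h4)
  -- A preimage of `y` is a fixed point of the contraction `x ↦ y - t • g x`.
  have hsurj : Function.Surjective f := by
    intro y
    have hK : ContractingWith (Real.toNNReal (t * C)) fun x => y - t • g x := by
      refine ⟨by rw [← NNReal.coe_lt_coe, Real.coe_toNNReal _ (by positivity)]; exact_mod_cast ht,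
        LipschitzWith.of_dist_le_mul fun x z => ?_⟩
      rw [Real.coe_toNNReal _ (by positivity), dist_eq_norm, dist_eq_norm, sub_sub_sub_cancel_left,
        norm_sub_rev]
      exact hlip x z
    refine ⟨hK.fixedPoint, ?_⟩
    have : y - t • g hK.fixedPoint = hK.fixedPoint := hK.fixedPoint_isFixedPt
    simp only [hf]
    nth_rewrite 1 [← this]
    abel
  have himage : f '' Metric.closedBall (0 : E) R = Metric.closedBall (0 : E) R := by
    have hout : ∀ x, R < ‖x‖ → f x = x := fun x hx => by simp [hf, hR x hx]
    apply Set.Subset.antisymm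
    · rintro _ ⟨x, hx, rfl⟩
      by_contra h
      simp only [mem_closedBall_zero_iff, not_le] at h hx
      have := hinj (hout _ h)
      rw [this] at h
      exact absurd hx (not_le.2 h)
    · intro y hy
      obtain ⟨x, rfl⟩ := hsurj y
      refine ⟨x, ?_, rfl⟩
      by_contra h
      simp only [mem_closedBall_zero_iff, not_le] at h hy
      rw [hout x h] at hy
      exact absurd hy (not_le.2 h)
  have hderiv : ∀ x, HasFDerivAt f (ContinuousLinearMap.id ℝ E + t • fderiv ℝ g x) x := fun x =>
    (hasFDerivAt_id x).add
      (((hg.differentiable one_ne_zero) x).hasFDerivAt.const_smul t)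
  have key := integral_image_eq_integral_abs_det_fderiv_smul (volume : Measure E)
    (Metric.isClosed_closedBall (x := (0 : E)) (ε := R)).measurableSet
    (fun x _ => (hderiv x).hasFDerivWithinAt) hinj.injOn q
  rw [himage] at key
  rw [key]
  refine integral_congr_ae (Filter.Eventually.of_forall fun x => ?_)
  have hn : ‖t • fderiv ℝ g x‖ < 1 := by
    rw [norm_smul, Real.norm_of_nonneg ht0]
    exact (mul_le_mul_of_nonneg_left (norm_fderiv_le_of_lipschitz ℝ hC) ht0).trans_lt ht
  simp only [smul_eq_mul]
  rw [abs_of_pos (det_id_add_pos hn)]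

/-- A `C¹` compactly supported perturbation of the identity has a zero. -/
theorem exists_add_eq_zero_of_contDiff {g : E → E} (hg : ContDiff ℝ 1 g)
    (hs : HasCompactSupport g) : ∃ x, x + g x = 0 := by
  borelize E
  by_contra! hne
  obtain ⟨R, hR0, hR⟩ : ∃ R, 0 < R ∧ ∀ x, R < ‖x‖ → g x = 0 := by
    obtain ⟨R, hR⟩ := hs.isCompact.isBounded.subset_closedBall (0 : E)
    refine ⟨max R 1, by positivity, fun x hx => ?_⟩
    by_contra h
    have := mem_closedBall_zero_iff.1 (hR (subset_tsupport g h))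
    exact absurd hx (not_lt.2 (this.trans (le_max_left _ _)))
  obtain ⟨C, hC⟩ := hg.lipschitzWith_of_hasCompactSupport hs one_ne_zero
  set B := Metric.closedBall (0 : E) R
  have hB : IsCompact B := isCompact_closedBall _ _
  have h0B : (0 : E) ∈ B := Metric.mem_closedBall_self hR0.le
  have hgc : Continuous g := hg.continuous
  have hA : Continuous (fderiv ℝ g) := hg.continuous_fderiv one_ne_zero
  have hfc : Continuous fun x => x + g x := by fun_prop
  obtain ⟨x₀, -, hx₀⟩ := hB.exists_isMinOn ⟨0, h0B⟩ hfc.norm.continuousOn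
  obtain ⟨S, hS⟩ := hB.exists_bound_of_continuousOn hfc.continuousOn
  have hDc : Continuous fun x => (ContinuousLinearMap.id ℝ E + fderiv ℝ g x).det :=
    ContinuousLinearMap.continuous_det.comp (by fun_prop)
  obtain ⟨M, hM⟩ := hB.exists_bound_of_continuousOn hDc.continuousOn
  have hM0 : 0 ≤ M := (norm_nonneg _).trans (hM 0 h0B)
  -- `δ` bounds `‖x + g x‖` from below on `B`, while `T` bounds `‖x‖` and `‖x + g x‖` from above
  -- there; thus `0 ≤ 1 - c * ‖y‖ ^ 2` for `y = x` and `y = x + g x`.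
  set δ := min R ‖x₀ + g x₀‖
  have hδ : 0 < δ := lt_min hR0 (norm_pos_iff.2 (hne x₀))
  set T := max R S
  have hT : 0 < T := lt_max_of_lt_left hR0
  set c := 1 / T ^ 2
  have hc : 0 < c := by positivity
  have hcT : ∀ r, 0 ≤ r → r ≤ T → c * r ^ 2 ≤ 1 := by
    intro r hr hrT
    rw [div_mul_eq_mul_div, one_mul, div_le_one (by positivity)]
    gcongr
  have hcδ : c * δ ^ 2 ≤ 1 := hcT δ hδ.le ((min_le_left _ _).trans (le_max_left _ _))
  set a := 1 - c * (δ / 2) ^ 2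
  set b := 1 - c * δ ^ 2
  have hcδ0 : 0 < c * δ ^ 2 := by positivity
  have ha : 0 < a := by
    have : c * (δ / 2) ^ 2 = c * δ ^ 2 / 4 := by ring
    simp only [a]; linarith
  have hb : 0 ≤ b := by simp only [b]; linarith
  have hba : b < a := by
    have : c * (δ / 2) ^ 2 = c * δ ^ 2 / 4 := by ring
    simp only [a, b]; linarith
  -- The change of variables identity holds for all small `t`, hence as an identity of polynomials
  -- in `t`, and `t = 1` may be substituted.
  have hid : ∀ k : ℕ, ∫ x in B, (ContinuousLinearMap.id ℝ E + fderiv ℝ g x).det *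
      (1 - c * ‖x + g x‖ ^ 2) ^ k = ∫ x in B, (1 - c * ‖x‖ ^ 2) ^ k := by
    intro k
    obtain ⟨p, hp⟩ := exists_polynomial_eval_eq_det hA
    let n : Polynomial C(E, ℝ) :=
      Polynomial.C ⟨fun x => ‖x‖ ^ 2, by fun_prop⟩ +
        Polynomial.C ⟨fun x => 2 * inner ℝ x (g x), by fun_prop⟩ * Polynomial.X +
        Polynomial.C ⟨fun x => ‖g x‖ ^ 2, by fun_prop⟩ * Polynomial.X ^ 2
    obtain ⟨P, hP⟩ := exists_polynomial_eval_eq_integral (volume : Measure E) hB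
      (p * (1 - Polynomial.C (ContinuousMap.const E c) * n) ^ k)
    have hP' : ∀ t, ∫ x in B, (ContinuousLinearMap.id ℝ E + t • fderiv ℝ g x).det *
        (1 - c * ‖x + t • g x‖ ^ 2) ^ k = P.eval t := by
      intro t
      rw [← hP]
      congr 1
      ext x
      rw [hp]
      simp only [Polynomial.map_mul, Polynomial.eval_mul, Polynomial.map_pow, Polynomial.eval_pow,
        Polynomial.map_sub, Polynomial.eval_sub, n, Polynomial.map_add, Polynomial.eval_add,
        Polynomial.map_C, Polynomial.eval_C, Polynomial.map_X, Polynomial.eval_X,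
        Polynomial.map_one, Polynomial.eval_one]
      congr 3
      rw [norm_add_sq_real, inner_smul_right, norm_smul, mul_pow, Real.norm_eq_abs, sq_abs]
      simp only [ContinuousMap.const_apply, RingHom.coe_coe, ContinuousMap.evalAlgHom_apply,
        ContinuousMap.coe_mk]
      ring
    have hPC : P = Polynomial.C (∫ x in B, (1 - c * ‖x‖ ^ 2) ^ k) := by
      apply Polynomial.eq_of_infinite_eval_eq
      refine (Set.Icc_infinite (show (0 : ℝ) < 1 / (C + 1) by positivity)).mono fun t ht => ?_
      have htC : t * C < 1 := by
        have h1 : t * (C + 1) ≤ 1 := by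
          have := ht.2
          rwa [le_div_iff₀ (by positivity)] at this
        rcases ht.1.eq_or_lt with h | h
        · rw [← h]; simp
        · linarith
      simp only [Set.mem_ofPred_eq, Polynomial.eval_C]
      rw [← hP']
      exact integral_det_mul_comp_eq hg hR hC ht.1 htC fun y => (1 - c * ‖y‖ ^ 2) ^ k
    have := hP' 1
    simp only [one_smul] at this
    rw [this, hPC, Polynomial.eval_C]
  set u := (volume : Measure E).real (Metric.closedBall (0 : E) (δ / 2))
  set v := (volume : Measure E).real B
  have hu : 0 < u := by
    refine ENNReal.toReal_pos (Metric.measure_closedBall_pos _ _ (by positivity)).ne' ?_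
    exact (isCompact_closedBall _ _).measure_lt_top.ne
  have hlow : ∀ k : ℕ, a ^ k * u ≤ ∫ x in B, (1 - c * ‖x‖ ^ 2) ^ k := by
    intro k
    have hint : IntegrableOn (fun x : E => (1 - c * ‖x‖ ^ 2) ^ k) B :=
      ContinuousOn.integrableOn_compact hB (by fun_prop)
    have hsub : Metric.closedBall (0 : E) (δ / 2) ⊆ B :=
      Metric.closedBall_subset_closedBall (by linarith [min_le_left R ‖x₀ + g x₀‖])
    calc a ^ k * u = ∫ x in Metric.closedBall (0 : E) (δ / 2), a ^ k := by
          rw [setIntegral_const, smul_eq_mul, mul_comm]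
      _ ≤ ∫ x in Metric.closedBall (0 : E) (δ / 2), (1 - c * ‖x‖ ^ 2) ^ k := by
          refine setIntegral_mono_on ?_ (hint.mono_set hsub) measurableSet_closedBall fun x hx => ?_
          · exact integrableOn_const (isCompact_closedBall _ _).measure_lt_top.ne
          · have := mem_closedBall_zero_iff.1 hx
            simp only [a]
            gcongr
      _ ≤ _ := by
          refine setIntegral_mono_set hint ?_ hsub.eventuallyLE
          refine (ae_restrict_iff' measurableSet_closedBall).2 (Filter.Eventually.of_forall ?_)
          intro x hx
          have := hcT ‖x‖ (norm_nonneg _) ((mem_closedBall_zero_iff.1 hx).trans (le_max_left _ _))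
          exact pow_nonneg (by linarith) _
  have hup : ∀ k : ℕ, ∫ x in B, (ContinuousLinearMap.id ℝ E + fderiv ℝ g x).det *
      (1 - c * ‖x + g x‖ ^ 2) ^ k ≤ M * b ^ k * v := by
    intro k
    refine (Real.le_norm_self _).trans
      (norm_setIntegral_le_of_norm_le_const hB.measure_lt_top fun x hx => ?_)
    rw [norm_mul, norm_pow]
    have h1 := hcT ‖x + g x‖ (norm_nonneg _) ((hS x hx).trans (le_max_right _ _))
    have h2 : δ ≤ ‖x + g x‖ := (min_le_right _ _).trans (hx₀ hx)
    have h3 : c * δ ^ 2 ≤ c * ‖x + g x‖ ^ 2 := by gcongr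
    have h4 : ‖1 - c * ‖x + g x‖ ^ 2‖ ≤ b := by
      rw [Real.norm_of_nonneg (by linarith)]
      simp only [b]; linarith
    have := hM x hx
    gcongr
  -- `a ^ k * u ≤ M * b ^ k * v` fails for large `k`, because `b < a`.
  obtain ⟨k, hk⟩ := exists_pow_lt_of_lt_one (show 0 < u / (M * v + 1) by positivity)
    ((div_lt_one ha).2 hba)
  rw [div_pow, div_lt_div_iff₀ (by positivity) (by positivity)] at hk
  have h1 := (hlow k).trans ((hid k).symm.le.trans (hup k))
  have h2 : 0 ≤ b ^ k := by positivity
  linarith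

/-- A form of Brouwer's theorem: a continuous vector field that points outwards away from a ball
vanishes somewhere. -/
theorem exists_eq_zero_of_inner_pos {V : E → E} (hV : Continuous V) {R : ℝ}
    (hR : ∀ x, R < ‖x‖ → 0 < inner ℝ (V x) x) : ∃ x, V x = 0 := by
  by_contra! hne
  have hR' : max R 1 < max R 1 + 1 := by linarith
  let χ : ContDiffBump (0 : E) := ⟨max R 1, max R 1 + 1, by positivity, hR'⟩
  set B := Metric.closedBall (0 : E) (max R 1 + 1)
  have hB : IsCompact B := isCompact_closedBall _ _
  -- `W` interpolates between `V` on a ball and the identity far away; it has no zeros either, and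
  -- it stays without zeros when `V` is replaced by a close `C¹` field `U`.
  let W : E → E := fun x => χ x • V x + (1 - χ x) • x
  have hχ : Continuous χ := χ.continuous
  have hWc : Continuous W := by fun_prop
  have hW : ∀ x, W x ≠ 0 := by
    intro x hx
    rcases le_or_gt ‖x‖ (max R 1) with h | h
    · have h1 : χ x = 1 := χ.one_of_mem_closedBall (mem_closedBall_zero_iff.2 h)
      simp only [W, h1] at hx
      exact hne x (by simpa using hx)
    · have h1 := hR x ((le_max_left _ _).trans_lt h)
      have h2 : inner ℝ (W x) x = χ x * inner ℝ (V x) x + (1 - χ x) * ‖x‖ ^ 2 := by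
        simp [W, inner_add_left, inner_smul_left]
      rw [hx, inner_zero_left] at h2
      have h3 : 0 < ‖x‖ ^ 2 := pow_pos ((by positivity : 0 < max R 1).trans h) 2
      have h4 := χ.nonneg (x := x)
      have h5 := χ.le_one (x := x)
      rcases h4.eq_or_lt with h | h
      · rw [← h] at h2; linarith
      · nlinarith [mul_pos h h1, mul_nonneg (sub_nonneg.2 h5) h3.le]
  obtain ⟨x₀, -, hx₀⟩ := hB.exists_isMinOn ⟨0, Metric.mem_closedBall_self (by positivity)⟩
    hWc.norm.continuousOn
  have hm : 0 < ‖W x₀‖ := norm_pos_iff.2 (hW x₀)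
  obtain ⟨U, hU, hUV⟩ : ∃ U : E → E, ContDiff ℝ 1 U ∧ ∀ x ∈ B, ‖U x - V x‖ < ‖W x₀‖ := by
    have hd := ContinuousMap.dense_setOfPred_contDiff (E := E) (F := E) ⟨V, hV⟩
    rw [mem_closure_iff_nhds_basis
      (nhds_basis_uniformity Metric.uniformity_basis_dist.compactConvergenceUniformity)] at hd
    obtain ⟨U, hU, h⟩ := hd (B, ‖W x₀‖) ⟨hB, hm⟩
    have hU' : ContDiff ℝ (⊤ : ℕ∞) U := hU
    refine ⟨U, hU'.of_le (by exact_mod_cast le_top), fun x hx => ?_⟩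
    have := h x hx
    rw [← dist_eq_norm]
    exact this
  have hg : ContDiff ℝ 1 fun x => χ x • (U x - x) := by
    have : ContDiff ℝ 1 χ := χ.contDiff
    fun_prop
  obtain ⟨x, hx⟩ := exists_add_eq_zero_of_contDiff hg (χ.hasCompactSupport.smul_right)
  have hxW : W x = -(χ x • (U x - V x)) := by
    calc W x = (x + χ x • (U x - x)) - χ x • (U x - V x) := by simp only [W]; module
      _ = _ := by rw [hx, zero_sub]
  by_cases hxB : x ∈ B
  · have h1 : ‖W x₀‖ ≤ ‖W x‖ := hx₀ hxB
    rw [hxW, norm_neg, norm_smul, Real.norm_of_nonneg χ.nonneg] at h1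
    nlinarith [hUV x hxB, χ.le_one (x := x), χ.nonneg (x := x), norm_nonneg (U x - V x)]
  · have h1 : χ x = 0 := χ.zero_of_le_dist (by
      simpa [B, χ] using (not_le.1 fun h => hxB (mem_closedBall_zero_iff.2 h)).le)
    rw [h1] at hxW
    exact hW x (by simpa using hxW)

end Brouwer

/-! ### Separating functionals of a conical partition -/

section Cones

variable {ι E : Type*} [NormedAddCommGroup E] [NormedSpace ℝ E]

theorem exists_separating_of_disjoint_interior {C D : ConvexCone ℝ E}
    (hC : (interior (C : Set E)).Nonempty) (hD : (interior (D : Set E)).Nonempty)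
    (hCD : Disjoint (interior (C : Set E)) (interior (D : Set E))) :
    ∃ f : E →L[ℝ] ℝ, (∀ x ∈ C, 0 ≤ f x) ∧ (∀ x ∈ D, f x ≤ 0) ∧
      ∀ x ∈ interior (C : Set E), 0 < f x := by
  have hcl : ∀ K : ConvexCone ℝ E, (interior (K : Set E)).Nonempty →
      (K : Set E) ⊆ closure (interior (K : Set E)) := fun K hK => by
    rw [K.convex.closure_interior_eq_closure_of_nonempty_interior hK]
    exact subset_closure
  have hdisj : Disjoint (interior (C : Set E)) (D : Set E) :=
    (hCD.closure_right isOpen_interior).mono_right (hcl D hD)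
  obtain ⟨f, u, hfC, hfD⟩ :=
    geometric_hahn_banach_open C.convex.interior isOpen_interior D.convex hdisj
  -- As `D` is a cone, its points can be scaled towards the origin, so the level `u` is not
  -- positive.
  have hu : u ≤ 0 := by
    obtain ⟨b, hb⟩ := hD
    by_contra! hu
    have hfb : 0 < f b := hu.trans_le (hfD b (interior_subset hb))
    have := hfD _ (D.smul_mem (show 0 < u / (2 * f b) by positivity) (interior_subset hb))
    rw [map_smul, smul_eq_mul] at this
    have h2 : u / (2 * f b) * f b = u / 2 := by field_simp
    linarith
  have hD0 : ∀ b ∈ D, 0 ≤ f b := by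
    intro b hb
    by_contra! hfb
    have := hfD _ (D.smul_mem (show 0 < (1 - u) / (-f b) from
      div_pos (by linarith) (by linarith)) hb)
    rw [map_smul, smul_eq_mul] at this
    have h2 : (1 - u) / (-f b) * f b = u - 1 := by
      have : f b ≠ 0 := hfb.ne
      field_simp
      ring
    linarith
  refine ⟨-f, fun x hx => ?_, fun x hx => ?_, fun x hx => ?_⟩
  · have : (C : Set E) ⊆ {x | 0 ≤ (-f) x} :=
      (hcl C hC).trans (closure_minimal (fun y hy => by
        have := hfC y hy
        simp only [Set.mem_ofPred_eq, neg_apply]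
        linarith) (isClosed_le continuous_const (-f).continuous))
    exact this hx
  · simpa using hD0 x hx
  · have := hfC x hx
    simp only [neg_apply]
    linarith

theorem IsConicalPartition.exists_alternating_separating {C : ι → ConvexCone ℝ E}
    (hC : IsConicalPartition C) :
    ∃ l : ι → ι → E →L[ℝ] ℝ, (∀ i j, l j i = -l i j) ∧ (∀ i j, ∀ x ∈ C i, 0 ≤ l i j x) ∧
      ∀ i j, i ≠ j → ∀ x ∈ interior (C i : Set E), 0 < l i j x := by
  have h : ∀ i j, ∃ f : E →L[ℝ] ℝ, (∀ x ∈ C i, 0 ≤ f x) ∧ (∀ x ∈ C j, f x ≤ 0) ∧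
      (i ≠ j → ∀ x ∈ interior (C i : Set E), 0 < f x) := by
    intro i j
    rcases eq_or_ne i j with rfl | hij
    · exact ⟨0, by simp, by simp, fun h => absurd rfl h⟩
    · obtain ⟨f, h1, h2, h3⟩ := exists_separating_of_disjoint_interior (hC.nonempty_interior i)
        (hC.nonempty_interior j) (hC.isConvexPartition.disjoint_interior hij)
      exact ⟨f, h1, h2, fun _ => h3⟩
  choose f h1 h2 h3 using h
  refine ⟨fun i j => f i j - f j i, fun i j => (neg_sub _ _).symm, fun i j x hx => ?_,
    fun i j hij x hx => ?_⟩
  · have := h1 i j x hx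
    have := h2 j i x hx
    simp only [sub_apply]
    linarith
  · have := h3 i j hij x hx
    have := h2 j i x (interior_subset hx)
    simp only [sub_apply]
    linarith

/-- The functionals `s i = ∑ j, l i j` built from an alternating family of separating functionals.
They vanish simultaneously only at the origin, since a common zero lies, together with its
negative, in every cone. -/
theorem IsConicalPartition.exists_functionals [Fintype ι] {C : ι → ConvexCone ℝ E}
    (hC : IsConicalPartition C) :
    ∃ s : ι → E →L[ℝ] ℝ, ∑ i, s i = 0 ∧ (∀ i, ∀ x ∈ C i, 0 ≤ s i x) ∧
      ∀ x, (∀ i, s i x = 0) → x = 0 := by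
  obtain ⟨l, hanti, hnonneg, hpos⟩ := hC.exists_alternating_separating
  refine ⟨fun i => ∑ j, l i j, ?_, fun i x hx => ?_, ?_⟩
  · have h : ∑ i, ∑ j, l i j = -∑ i, ∑ j, l i j := by
      nth_rewrite 1 [Finset.sum_comm]
      simp only [← Finset.sum_neg_distrib]
      exact Finset.sum_congr rfl fun i _ => Finset.sum_congr rfl fun j _ => hanti _ _
    refine ContinuousLinearMap.ext fun x => ?_
    have := congrArg (fun f : E →L[ℝ] ℝ => f x) h
    simp only [neg_apply] at this
    simp only [zero_apply]
    linarith
  · rw [sum_apply]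
    exact Finset.sum_nonneg fun j _ => hnonneg i j x hx
  · have key : ∀ x, (∀ i, (∑ j, l i j) x = 0) → ∀ k, x ∈ C k := by
      intro x hx k
      have hl : ∀ i, x ∈ C i → ∀ j, l i j x = 0 := by
        intro i hi j
        have h := hx i
        rw [sum_apply] at h
        exact (Finset.sum_eq_zero_iff_of_nonneg fun j _ => hnonneg i j x hi).1 h j
          (Finset.mem_univ j)
      obtain ⟨w, hw⟩ := hC.nonempty_interior k
      -- For small `t > 0` the point `x + t • w` lies in a cone containing `x`. Every such cone
      -- other than `C k` is ruled out by the functional that separates it from `w`, which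
      -- vanishes at `x`.
      set F : Set E := ⋃ i ∈ {i | x ∉ C i}, (C i : Set E)
      have hF : IsClosed F :=
        (Set.toFinite _).isClosed_biUnion fun i _ => hC.isConvexPartition.isClosed i
      have hxF : x ∉ F := by simp [F]
      have hev : ∀ᶠ t : ℝ in nhdsWithin 0 (Set.Ioi 0), x + t • w ∈ Fᶜ := by
        have hcont : Continuous fun t : ℝ => x + t • w := by fun_prop
        have := hcont.continuousAt (x := 0) (hF.isOpen_compl.mem_nhds (by simpa using hxF))
        exact nhdsWithin_le_nhds this
      obtain ⟨t, htF, ht⟩ := (hev.and self_mem_nhdsWithin).exists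
      have hcov : x + t • w ∈ ⋃ i, (C i : Set E) := by
        rw [hC.isConvexPartition.iUnion_eq]; trivial
      obtain ⟨i, hi⟩ := Set.mem_iUnion.1 hcov
      have hxi : x ∈ C i := by
        by_contra h
        exact htF (Set.mem_biUnion h hi)
      by_cases hik : k = i
      · rwa [hik]
      · exfalso
        have h1 := hnonneg i k _ hi
        rw [map_add, map_smul, hl i hxi k, zero_add, hanti k i, smul_eq_mul] at h1
        have h2 := mul_pos (Set.mem_Ioi.1 ht) (hpos k i hik w hw)
        simp only [neg_apply] at h1
        linarith
    intro x hx
    exact hC.eq_zero_of_common_line x fun k =>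
      ⟨key x hx k, key (-x) (fun i => by rw [map_neg, hx i, neg_zero]) k⟩

end Cones

/-! ### The balancing point of a family of weights -/

section Zero

/-- By a dimension count, `x ↦ (s i x)` maps onto the hyperplane of vectors with coordinate sum
`0`. -/
theorem exists_eq_apply_of_sum_eq_zero {ι E : Type*} [Fintype ι] [NormedAddCommGroup E]
    [NormedSpace ℝ E] {s : ι → E →L[ℝ] ℝ} (hs : ∑ i, s i = 0)
    (hinj : ∀ x, (∀ i, s i x = 0) → x = 0) (hdim : Fintype.card ι = Module.finrank ℝ E + 1)
    {z : ι → ℝ} (hz : ∑ i, z i = 0) : ∃ y, ∀ i, s i y = z i := by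
  classical
  let S : E →ₗ[ℝ] ι → ℝ := LinearMap.pi fun i => (s i : E →ₗ[ℝ] ℝ)
  let φ : Module.Dual ℝ (ι → ℝ) := ∑ i, LinearMap.proj i
  have hφ : ∀ v, φ v = ∑ i, v i := fun v => by simp [φ]
  have hne : φ ≠ 0 := by
    obtain ⟨i⟩ : Nonempty ι := Fintype.card_pos_iff.1 (by omega)
    intro h
    have := hφ (Pi.single i 1)
    rw [h] at this
    simp at this
  have hS : Function.Injective S := (injective_iff_map_eq_zero S).2 fun x hx =>
    hinj x fun i => congrFun hx i
  have hle : LinearMap.range S ≤ LinearMap.ker φ := by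
    rintro _ ⟨x, rfl⟩
    rw [LinearMap.mem_ker, hφ]
    have := congrArg (fun f : E →L[ℝ] ℝ => f x) hs
    simp only [sum_apply, zero_apply] at this
    exact this
  have hrank : Module.finrank ℝ (LinearMap.range S) = Module.finrank ℝ (LinearMap.ker φ) := by
    have h1 := Module.Dual.finrank_ker_add_one_of_ne_zero hne
    rw [Module.finrank_fintype_fun_eq_card] at h1
    rw [LinearMap.finrank_range_of_inj hS]
    omega
  have hz' : z ∈ LinearMap.range S := by
    rw [Submodule.eq_of_le_of_finrank_eq hle hrank, LinearMap.mem_ker, hφ, hz]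
  obtain ⟨y, hy⟩ := hz'
  exact ⟨y, fun i => congrFun hy i⟩

variable {ι E : Type*} [Fintype ι] [NormedAddCommGroup E] [InnerProductSpace ℝ E]
  [FiniteDimensional ℝ E]

/-- Weights `Γ` of total mass `dim E`, spread over `dim E + 1` indices, can all be made less than
`1` at once, provided that `s i x` is bounded above where `Γ x i` is positive. The point `x`
satisfies bounds that do not depend on `Γ`. -/
theorem exists_forall_lt_one_and_le {s : ι → E →L[ℝ] ℝ} (hs : ∑ i, s i = 0)
    (hinj : ∀ x, (∀ i, s i x = 0) → x = 0) (hdim : Fintype.card ι = Module.finrank ℝ E + 1)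
    {Γ : E → ι → ℝ} (hΓ : ∀ i, Continuous fun x => Γ x i) (hΓ0 : ∀ x i, 0 ≤ Γ x i)
    (hΓs : ∀ x, ∑ i, Γ x i = Module.finrank ℝ E) {M : ℝ} (hM0 : 0 ≤ M)
    (hM : ∀ x i, 0 < Γ x i → s i x ≤ M) : ∃ x, ∀ i, Γ x i < 1 ∧ s i x ≤ M := by
  have hs' : ∀ x, ∑ i, s i x = 0 := fun x => by
    have := congrArg (fun f : E →L[ℝ] ℝ => f x) hs
    simpa [sum_apply] using this
  rcases (Module.finrank ℝ E).eq_zero_or_pos with h0 | hpos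
  · refine ⟨0, fun i => ⟨?_, by simpa using hM0⟩⟩
    have h1 := Finset.single_le_sum (fun j _ => hΓ0 0 j) (Finset.mem_univ i)
    rw [hΓs, h0] at h1
    exact h1.trans_lt (by simp)
  set n : ℝ := ((Module.finrank ℝ E : ℕ) : ℝ) with hn
  have hn1 : 1 ≤ n := by rw [hn]; exact_mod_cast hpos
  have hcard : (Fintype.card ι : ℝ) = n + 1 := by rw [hdim]; push_cast; rfl
  set b := n / (n + 1) with hb
  have hb1 : b + 1 / (n + 1) = 1 := by rw [hb]; field_simp
  have hb2 : 0 ≤ b - 1 / (n + 1) := by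
    rw [hb, ← sub_div]
    exact div_nonneg (by linarith) (by linarith)
  -- `η` is small enough for the correction `η * s i x` at the zero to be less than `1 / (n + 1)`.
  set η := 1 / ((n + 1) ^ 2 * (n * M + 1)) with hη
  have hηpos : 0 < η := by positivity
  have hηM : η * (n * M) < (1 / (n + 1)) ^ 2 := by
    have h : η * (n * M + 1) = (1 / (n + 1)) ^ 2 := by
      have : n * M + 1 ≠ 0 := by positivity
      rw [hη]; field_simp
    linarith
  have hΓM : ∀ x, ∑ i, Γ x i * s i x ≤ n * M := by
    intro x
    rw [← hΓs x, Finset.sum_mul]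
    refine Finset.sum_le_sum fun i _ => ?_
    rcases (hΓ0 x i).eq_or_lt with h | h
    · simp [← h]
    · exact mul_le_mul_of_nonneg_left (hM x i h) h.le
  let z : E → ι → ℝ := fun x i => b - Γ x i + η * s i x
  have hz : ∀ x, ∑ i, z x i * s i x = η * ∑ i, s i x ^ 2 - ∑ i, Γ x i * s i x := by
    intro x
    calc ∑ i, z x i * s i x
        = b * ∑ i, s i x + (η * ∑ i, s i x ^ 2 - ∑ i, Γ x i * s i x) := by
          rw [Finset.mul_sum, Finset.mul_sum, ← Finset.sum_sub_distrib, ← Finset.sum_add_distrib]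
          exact Finset.sum_congr rfl fun i _ => by simp only [z]; ring
      _ = _ := by rw [hs', mul_zero, zero_add]
  -- `V` is the image of `z` under the adjoint of `x ↦ (s i x)`.
  let V : E → E := fun x => ∑ i, z x i • (InnerProductSpace.toDual ℝ E).symm (s i)
  have hV : ∀ x y, inner ℝ (V x) y = ∑ i, z x i * s i y := by
    intro x y
    simp [V, sum_inner, inner_smul_left]
  have hVc : Continuous V := by
    refine continuous_finsetSum _ fun i _ => ?_
    have := hΓ i
    exact (by fun_prop : Continuous fun x => b - Γ x i + η * s i x).smul continuous_const
  obtain ⟨κ, hκ, hgrow⟩ : ∃ κ : ℝ, 0 < κ ∧ ∀ x, ‖x‖ ^ 2 ≤ κ * ∑ i, s i x ^ 2 := by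
    let S : E →ₗ[ℝ] ι → ℝ := LinearMap.pi fun i => (s i : E →ₗ[ℝ] ℝ)
    have hS : LinearMap.ker S = ⊥ := LinearMap.ker_eq_bot'.2 fun x hx =>
      hinj x fun i => congrFun hx i
    obtain ⟨K, hK, hKS⟩ := S.exists_antilipschitzWith hS
    refine ⟨(K : ℝ) ^ 2, by positivity, fun x => ?_⟩
    have h1 : ‖x‖ ≤ K * ‖S x‖ := by simpa using hKS.le_mul_dist x 0
    have h2 : ‖S x‖ ≤ Real.sqrt (∑ i, s i x ^ 2) := by
      refine (pi_norm_le_iff_of_nonneg (Real.sqrt_nonneg _)).2 fun i => ?_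
      refine Real.abs_le_sqrt ?_
      exact Finset.single_le_sum (f := fun i => s i x ^ 2) (fun j _ => sq_nonneg _)
        (Finset.mem_univ i)
    calc ‖x‖ ^ 2 ≤ (K * Real.sqrt (∑ i, s i x ^ 2)) ^ 2 := by
          gcongr
          exact h1.trans (by gcongr)
      _ = _ := by rw [mul_pow, Real.sq_sqrt (Finset.sum_nonneg fun i _ => sq_nonneg _)]
  have hfar : ∀ x, κ * (n * M) / η + 1 < ‖x‖ → 0 < inner ℝ (V x) x := by
    intro x hx
    rw [hV, hz]
    have h0 : 0 ≤ κ * (n * M) / η := by positivity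
    have h1 : κ * (n * M) / η < ‖x‖ ^ 2 := by nlinarith
    have h2 := h1.trans_le (hgrow x)
    rw [div_lt_iff₀ hηpos] at h2
    have h3 : n * M < η * ∑ i, s i x ^ 2 := by
      refine lt_of_mul_lt_mul_left ?_ hκ.le
      linarith
    linarith [hΓM x]
  obtain ⟨x, hx⟩ := exists_eq_zero_of_inner_pos hVc hfar
  have hzsum : ∑ i, z x i = 0 := by
    simp only [z]
    rw [Finset.sum_add_distrib, Finset.sum_sub_distrib, ← Finset.mul_sum, hs', hΓs,
      Finset.sum_const, Finset.card_univ, nsmul_eq_mul, hcard, hb]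
    field_simp
    ring
  have hz0 : ∀ i, z x i = 0 := by
    -- `z x` lies in the range of `s` and is orthogonal to it.
    obtain ⟨y, hy⟩ := exists_eq_apply_of_sum_eq_zero hs hinj hdim hzsum
    have h := hV x y
    rw [hx, inner_zero_left] at h
    simp only [hy] at h
    have h' := (Finset.sum_eq_zero_iff_of_nonneg fun i _ => mul_self_nonneg (z x i)).1 h.symm
    exact fun i => mul_self_eq_zero.1 (h' i (Finset.mem_univ i))
  have hsq : ∀ i, |η * s i x| < 1 / (n + 1) := by
    intro i
    refine abs_lt_of_sq_lt_sq ?_ (by positivity)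
    have h1 : η * ∑ i, s i x ^ 2 ≤ n * M := by
      have := hz x
      simp only [hz0, zero_mul, Finset.sum_const_zero] at this
      linarith [hΓM x]
    have h2 : s i x ^ 2 ≤ ∑ i, s i x ^ 2 :=
      Finset.single_le_sum (f := fun i => s i x ^ 2) (fun j _ => sq_nonneg _) (Finset.mem_univ i)
    calc (η * s i x) ^ 2 = η * (η * s i x ^ 2) := by ring
      _ ≤ η * (η * ∑ i, s i x ^ 2) := by gcongr
      _ ≤ η * (n * M) := by gcongr
      _ < _ := hηM
  refine ⟨x, fun i => ?_⟩
  have h1 := abs_lt.1 (hsq i)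
  have h2 : b - Γ x i + η * s i x = 0 := hz0 i
  exact ⟨by linarith, hM x i (by linarith)⟩

end Zero

/-! ### Measures of translated convex sets -/

section Measures

theorem mem_vadd_set_iff_sub_mem {E : Type*} [AddCommGroup E] {K : Set E} {x y : E} :
    y ∈ x +ᵥ K ↔ y - x ∈ K := by
  rw [Set.mem_vadd_set_iff_neg_vadd_mem, vadd_eq_add, neg_add_eq_sub]

theorem exists_le_measureReal_vadd {ι E : Type*} [Fintype ι] [AddCommGroup E]
    [MeasurableSpace E] {C : ι → Set E}
    (hC : ⋃ i, C i = Set.univ) {α : ι → ℝ} (hα : ∑ i, α i = 1) (ν : Measure E)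
    [IsProbabilityMeasure ν] (x : E) : ∃ i, α i ≤ ν.real (x +ᵥ C i) := by
  by_contra! h
  have hne : (Finset.univ : Finset ι).Nonempty := by
    by_contra hne
    rw [Finset.not_nonempty_iff_eq_empty] at hne
    simp [hne] at hα
  have h1 : ∑ i, ν.real (x +ᵥ C i) < 1 :=
    hα ▸ Finset.sum_lt_sum_of_nonempty hne fun i _ => h i
  have h2 : ⋃ i, (x +ᵥ C i) = Set.univ := by
    rw [← Set.vadd_set_iUnion, hC, Set.vadd_set_univ]
  have h3 := measureReal_iUnion_fintype_le (μ := ν) fun i => x +ᵥ C i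
  rw [h2, probReal_univ] at h3
  linarith

/-- If `f` is nonnegative on `K`, then `x + K` lies in the half-space `f x ≤ f y`, whose measure
tends to `0` as `f x` grows. -/
theorem exists_bound_of_le_measureReal_vadd {E : Type*} [NormedAddCommGroup E] [NormedSpace ℝ E]
    [MeasurableSpace E] [BorelSpace E] (μ : Measure E) [IsFiniteMeasure μ] {K : Set E}
    {f : E →L[ℝ] ℝ} (hf : ∀ x ∈ K, 0 ≤ f x) {δ : ℝ} (hδ : 0 < δ) :
    ∃ M, ∀ x : E, δ ≤ μ.real (x +ᵥ K) → f x ≤ M := by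
  have hmeas : ∀ n : ℕ, MeasurableSet {y | (n : ℝ) < f y} := fun n =>
    (isOpen_lt continuous_const f.continuous).measurableSet
  have hlim := tendsto_measure_iInter_atTop (μ := μ) (s := fun n : ℕ => {y | (n : ℝ) < f y})
    (fun n => (hmeas n).nullMeasurableSet)
    (fun m n hmn y (hy : (n : ℝ) < f y) => lt_of_le_of_lt (Nat.cast_le.2 hmn) hy)
    ⟨0, measure_ne_top μ _⟩
  have hempty : ⋂ n : ℕ, {y | (n : ℝ) < f y} = ∅ := by
    refine Set.eq_empty_iff_forall_notMem.2 fun y hy => ?_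
    obtain ⟨n, hn⟩ := exists_nat_ge (f y)
    exact absurd (Set.mem_iInter.1 hy n) (not_lt.2 hn)
  rw [hempty, measure_empty] at hlim
  obtain ⟨n, hn⟩ := (hlim.eventually_lt_const (ENNReal.ofReal_pos.2 hδ)).exists
  refine ⟨n, fun x hx => ?_⟩
  by_contra! hlt
  have hsub : x +ᵥ K ⊆ {y | (n : ℝ) < f y} := by
    intro y hy
    have h1 := hf _ (mem_vadd_set_iff_sub_mem.1 hy)
    rw [map_sub] at h1
    exact hlt.trans_le (by linarith)
  have h1 : μ.real (x +ᵥ K) < δ := by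
    rw [measureReal_def, ← ENNReal.lt_ofReal_iff_toReal_lt (measure_ne_top μ _)]
    exact (measure_mono hsub).trans_lt hn
  linarith

variable {E : Type*} [NormedAddCommGroup E] [InnerProductSpace ℝ E] [FiniteDimensional ℝ E]
  [MeasurableSpace E] [BorelSpace E]

/-- Continuity follows from the frontier of a convex set being a null set. -/
theorem continuous_measureReal_vadd {μ : Measure E} [IsFiniteMeasure μ] (hμ : μ ≪ volume)
    {K : Set E} (hK : Convex ℝ K) (hKc : IsClosed K) :
    Continuous fun x : E => μ.real (x +ᵥ K) := by
  refine continuous_iff_continuousAt.2 fun x => ?_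
  refine (ENNReal.tendsto_toReal (measure_ne_top μ _)).comp ?_
  have hm : ∀ x : E, MeasurableSet (x +ᵥ K) := fun x => (hKc.vadd x).measurableSet
  refine tendsto_measure_of_ae_tendsto_indicator_of_isFiniteMeasure _ (hm x) hm ?_
  have hnull : (volume : Measure E) ((fun y => y + -x) ⁻¹' frontier K) = 0 := by
    rw [measure_preimage_add_right]
    exact hK.addHaar_frontier volume
  have hae : ∀ᵐ y ∂μ, y + -x ∉ frontier K := hμ.ae_le (measure_eq_zero_iff_ae_notMem.1 hnull)
  filter_upwards [hae] with y hy
  rw [← sub_eq_add_neg] at hy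
  have hcont : Continuous fun x : E => y - x := by fun_prop
  simp only [mem_vadd_set_iff_sub_mem]
  by_cases h : y - x ∈ K
  · have hint : y - x ∈ interior K := by
      by_contra h'
      exact hy ⟨subset_closure h, h'⟩
    filter_upwards [hcont.continuousAt (isOpen_interior.mem_nhds hint)] with x' hx'
    exact iff_of_true (interior_subset hx') h
  · filter_upwards [hcont.continuousAt (hKc.isOpen_compl.mem_nhds h)] with x' hx'
    exact iff_of_false hx' h

end Measures

/-! ### Matchings -/

section Matching

/-- A matrix with row sums `1` and column sums less than `1` has, for each column `i₀`, a matching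
of all rows with columns other than `i₀` inside its support. -/
theorem exists_injective_avoiding_of_sum_lt_one {κ ι : Type*} [Fintype κ] [Fintype ι]
    {g : κ → ι → ℝ} (hg0 : ∀ j i, 0 ≤ g j i) (hrow : ∀ j, ∑ i, g j i = 1)
    (hcol : ∀ i, ∑ j, g j i < 1) (i₀ : ι) :
    ∃ f : κ → ι, f.Injective ∧ ∀ j, f j ≠ i₀ ∧ 0 < g j (f j) := by
  classical
  let t : κ → Finset ι := fun j => Finset.univ.filter fun i => i ≠ i₀ ∧ 0 < g j i
  obtain ⟨f, hf, hft⟩ := (Finset.all_card_le_biUnion_card_iff_exists_injective t).1 fun A => by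
    -- The rows of `A` have total mass `#A`, all of it in the columns of `N`, each of mass less
    -- than `1`; hence `#A < #N`.
    set N := insert i₀ (A.biUnion t) with hN
    have h1 : (A.card : ℝ) = ∑ i ∈ N, ∑ j ∈ A, g j i := by
      rw [Finset.sum_comm]
      have : ∀ j ∈ A, ∑ i ∈ N, g j i = 1 := fun j hj => by
        rw [← hrow j]
        refine Finset.sum_subset (Finset.subset_univ _) fun i _ hi => ?_
        by_contra h
        refine hi ?_
        by_cases hi0 : i = i₀
        · rw [hi0]; exact Finset.mem_insert_self _ _
        · exact Finset.mem_insert_of_mem (Finset.mem_biUnion.2 ⟨j, hj, Finset.mem_filter.2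
            ⟨Finset.mem_univ _, hi0, lt_of_le_of_ne (hg0 j i) (Ne.symm h)⟩⟩)
      rw [Finset.sum_congr rfl this]
      simp
    have h2 : ∑ i ∈ N, ∑ j ∈ A, g j i < ∑ i ∈ N, 1 :=
      Finset.sum_lt_sum_of_nonempty ⟨i₀, Finset.mem_insert_self _ _⟩ fun i _ =>
        (Finset.sum_le_univ_sum_of_nonneg fun j => hg0 j i).trans_lt (hcol i)
    rw [← h1, Finset.sum_const, nsmul_eq_mul, mul_one, Nat.cast_lt] at h2
    have h3 : N.card ≤ (A.biUnion t).card + 1 := Finset.card_insert_le _ _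
    omega
  exact ⟨f, hf, fun j => (Finset.mem_filter.1 (hft j)).2⟩

/-- An injection `Fin d → Fin (d + 1)` missing `i₀` extends to a permutation sending the last
index to `i₀`. -/
theorem exists_perm_snoc {d : ℕ} {f : Fin d → Fin (d + 1)} (hf : f.Injective) {i₀ : Fin (d + 1)}
    (hi₀ : ∀ j, f j ≠ i₀) :
    ∃ σ : Equiv.Perm (Fin (d + 1)), (∀ j, σ j.castSucc = f j) ∧ σ (Fin.last d) = i₀ := by
  have hinj : Function.Injective (Fin.snoc f i₀ : Fin (d + 1) → Fin (d + 1)) := by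
    intro a b
    induction a using Fin.lastCases with
    | last =>
      induction b using Fin.lastCases with
      | last => simp
      | cast b =>
        intro h
        simp only [Fin.snoc_last, Fin.snoc_castSucc] at h
        exact absurd h.symm (hi₀ b)
    | cast a =>
      induction b using Fin.lastCases with
      | last =>
        intro h
        simp only [Fin.snoc_last, Fin.snoc_castSucc] at h
        exact absurd h (hi₀ a)
      | cast b => simpa using fun h => hf h
  exact ⟨Equiv.ofBijective _ (Finite.injective_iff_bijective.1 hinj), by simp, by simp⟩

theorem exists_forall_of_antitone {F : Type*} [Finite F] {P : ℕ → F → Prop}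
    (hP : ∀ f, Antitone fun n => P n f) (h : ∀ n, ∃ f, P n f) : ∃ f, ∀ n, P n f := by
  by_contra! hne
  choose n hn using hne
  obtain ⟨N, hN⟩ := Finite.exists_le n
  obtain ⟨f, hf⟩ := h N
  exact hn f (hP f (hN f) hf)

end Matching

/-! ### Existence of the translation -/

section Translation

theorem isCompact_setOf_forall_le {ι E : Type*} [Fintype ι] [NormedAddCommGroup E]
    [NormedSpace ℝ E] [FiniteDimensional ℝ E] {s : ι → E →L[ℝ] ℝ} (hs : ∑ i, s i = 0)
    (hinj : ∀ x, (∀ i, s i x = 0) → x = 0) (M : ℝ) : IsCompact {x | ∀ i, s i x ≤ M} := by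
  let S : E →ₗ[ℝ] ι → ℝ := LinearMap.pi fun i => (s i : E →ₗ[ℝ] ℝ)
  have hS : LinearMap.ker S = ⊥ := LinearMap.ker_eq_bot'.2 fun x hx =>
    hinj x fun i => congrFun hx i
  -- The upper bounds and `∑ i, s i x = 0` imply lower bounds.
  have hcomp := (LinearMap.isClosedEmbedding_of_injective hS).isCompact_preimage
    (isCompact_Icc (a := fun _ : ι => M - Fintype.card ι * M) (b := fun _ => M))
  refine hcomp.of_isClosed_subset ?_ fun x hx => ⟨fun i => ?_, hx⟩
  · simp only [Set.ofPred_forall]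
    exact isClosed_iInter fun i => isClosed_le (s i).continuous continuous_const
  · have h1 : ∑ i, s i x = 0 := by
      have := congrArg (fun f : E →L[ℝ] ℝ => f x) hs
      simpa [sum_apply] using this
    have h2 := Finset.single_le_sum (f := fun j => M - s j x)
      (fun j _ => sub_nonneg.2 (hx j)) (Finset.mem_univ i)
    simp only [Finset.sum_sub_distrib, h1, Finset.sum_const, Finset.card_univ, nsmul_eq_mul] at h2
    have h3 : S x i = s i x := rfl
    rw [h3]
    linarith

variable {ι κ E : Type*} [Fintype ι] [Fintype κ] [NormedAddCommGroup E] [InnerProductSpace ℝ E]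
  [FiniteDimensional ℝ E] [MeasurableSpace E] [BorelSpace E]

/-- The matchings exist up to an error `ε`, at a point `x` whose bounds `s i x ≤ M` are uniform in
`ε`. -/
theorem exists_approximate_translation {C : ι → ConvexCone ℝ E} (hC : IsConicalPartition C)
    (hι : Fintype.card ι = Module.finrank ℝ E + 1) (hκ : Fintype.card κ = Module.finrank ℝ E)
    {α : ι → ℝ} (hα : ∑ i, α i = 1) {μ : κ → Measure E} [∀ j, IsProbabilityMeasure (μ j)]
    (hμ : ∀ j, μ j ≪ volume) {s : ι → E →L[ℝ] ℝ} (hs : ∑ i, s i = 0)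
    (hinj : ∀ x, (∀ i, s i x = 0) → x = 0) {M : ℝ} (hM0 : 0 ≤ M) {ε : ℝ} (hε : 0 < ε)
    (hM : ∀ i j x, α i - ε ≤ (μ j).real (x +ᵥ (C i : Set E)) → s i x ≤ M) :
    ∃ x, (∀ i, s i x ≤ M) ∧ ∀ i₀, ∃ f : κ → ι, (f.Injective ∧ ∀ j, f j ≠ i₀) ∧
      ∀ j, α (f j) - ε ≤ (μ j).real (x +ᵥ (C (f j) : Set E)) := by
  -- The slack `ε` makes every row of weights nonzero, so that rows can be normalised.
  let w : E → κ → ι → ℝ := fun x j i => max 0 ((μ j).real (x +ᵥ (C i : Set E)) - α i + ε)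
  have hw0 : ∀ x j i, 0 ≤ w x j i := fun x j i => le_max_left _ _
  have hwpos : ∀ x j i, 0 < w x j i → α i - ε ≤ (μ j).real (x +ᵥ (C i : Set E)) := by
    intro x j i h
    rcases lt_max_iff.1 h with h | h
    · exact absurd h (lt_irrefl _)
    · linarith
  have hwc : ∀ j i, Continuous fun x => w x j i := fun j i => by
    have := continuous_measureReal_vadd (hμ j) (C i).convex (hC.isConvexPartition.isClosed i)
    fun_prop
  have hZ : ∀ x j, 0 < ∑ i, w x j i := by
    intro x j
    obtain ⟨i, hi⟩ := exists_le_measureReal_vadd hC.isConvexPartition.iUnion_eq hα (μ j) x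
    exact Finset.sum_pos' (fun i _ => hw0 x j i)
      ⟨i, Finset.mem_univ i, lt_max_of_lt_right (by linarith)⟩
  let g : E → κ → ι → ℝ := fun x j i => w x j i / ∑ i, w x j i
  have hg0 : ∀ x j i, 0 ≤ g x j i := fun x j i => div_nonneg (hw0 x j i) (hZ x j).le
  have hg1 : ∀ x j, ∑ i, g x j i = 1 := fun x j => by
    simp only [g]
    rw [← Finset.sum_div, div_self (hZ x j).ne']
  have hgpos : ∀ x j i, 0 < g x j i → α i - ε ≤ (μ j).real (x +ᵥ (C i : Set E)) :=
    fun x j i h => hwpos x j i ((div_pos_iff_of_pos_right (hZ x j)).1 h)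
  obtain ⟨x, hx⟩ := exists_forall_lt_one_and_le hs hinj hι (Γ := fun x i => ∑ j, g x j i)
    (fun i => continuous_finsetSum _ fun j _ =>
      (hwc j i).div (continuous_finsetSum _ fun i _ => hwc j i) fun x => (hZ x j).ne')
    (fun x i => Finset.sum_nonneg fun j _ => hg0 x j i)
    (fun x => by rw [Finset.sum_comm, Finset.sum_congr rfl fun j _ => hg1 x j]; simp [hκ])
    hM0 (fun x i h => by
      obtain ⟨j, -, hj⟩ := Finset.exists_lt_of_sum_lt (f := fun _ => (0 : ℝ)) (by simpa using h)
      exact hM i j x (hgpos x j i hj))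
  refine ⟨x, fun i => (hx i).2, fun i₀ => ?_⟩
  obtain ⟨f, hf, h⟩ := exists_injective_avoiding_of_sum_lt_one (hg0 x) (hg1 x)
    (fun i => (hx i).1) i₀
  exact ⟨f, ⟨hf, fun j => (h j).1⟩, fun j => hgpos x j _ (h j).2⟩

/-- The limit `ε → 0` of `exists_approximate_translation`: at some `x`, for each `i₀` the measures
`μ j` can be matched with the cones other than `C i₀` so that each gives its cone the prescribed
mass. -/
theorem exists_translation {C : ι → ConvexCone ℝ E} (hC : IsConicalPartition C)
    (hι : Fintype.card ι = Module.finrank ℝ E + 1) (hκ : Fintype.card κ = Module.finrank ℝ E)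
    {α : ι → ℝ} (hα0 : ∀ i, 0 < α i) (hα : ∑ i, α i = 1) {μ : κ → Measure E}
    [∀ j, IsProbabilityMeasure (μ j)] (hμ : ∀ j, μ j ≪ volume) :
    ∃ x : E, ∀ i₀, ∃ f : κ → ι, (f.Injective ∧ ∀ j, f j ≠ i₀) ∧
      ∀ j, α (f j) ≤ (μ j).real (x +ᵥ (C (f j) : Set E)) := by
  obtain ⟨s, hs, hsC, hinj⟩ := hC.exists_functionals
  have : Nonempty ι := Fintype.card_pos_iff.1 (by omega)
  obtain ⟨i₁, hi₁⟩ := Finite.exists_min α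
  -- For `ε ≤ δ`, a cone of mass at least `α i - ε` has mass at least `δ`, which gives an `M`
  -- independent of `ε`.
  set δ := α i₁ / 2
  have hδ : 0 < δ := half_pos (hα0 i₁)
  obtain ⟨M, hM0, hM⟩ : ∃ M, 0 ≤ M ∧
      ∀ i j x, δ ≤ (μ j).real (x +ᵥ (C i : Set E)) → s i x ≤ M := by
    choose M hM using fun (p : ι × κ) =>
      exists_bound_of_le_measureReal_vadd (μ p.2) (hsC p.1) hδ
    obtain ⟨M', hM'⟩ := Finite.exists_le M
    exact ⟨max 0 M', le_max_left _ _, fun i j x h =>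
      (hM (i, j) x h).trans ((hM' (i, j)).trans (le_max_right _ _))⟩
  let F : ι → Type _ := fun i₀ => {f : κ → ι // f.Injective ∧ ∀ j, f j ≠ i₀}
  let ε : ℕ → ℝ := fun n => δ / (n + 1)
  have hε0 : ∀ n, 0 < ε n := fun n => by positivity
  have hεδ : ∀ n, ε n ≤ δ := fun n => div_le_self hδ.le (by
    have : (0 : ℝ) ≤ n := n.cast_nonneg
    linarith)
  have hεanti : Antitone ε := fun m n hmn => by
    simp only [ε]
    gcongr
  let A : ℕ → Set E := fun n => {x | ∀ i, s i x ≤ M} ∩ {x | ∀ i₀, ∃ f : F i₀,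
    ∀ j, α (f.1 j) - ε n ≤ (μ j).real (x +ᵥ (C (f.1 j) : Set E))}
  have hA : ∀ n, (A n).Nonempty := by
    intro n
    obtain ⟨x, hx, hf⟩ := exists_approximate_translation hC hι hκ hα hμ hs hinj hM0 (hε0 n)
      (fun i j x h => hM i j x (by
        have h1 : 2 * δ ≤ α i := by simp only [δ]; linarith [hi₁ i]
        linarith [hεδ n]))
    refine ⟨x, hx, fun i₀ => ?_⟩
    obtain ⟨f, h1, h2⟩ := hf i₀
    exact ⟨⟨f, h1⟩, h2⟩
  have hAanti : ∀ n, A (n + 1) ⊆ A n := fun n x hx => ⟨hx.1, fun i₀ => by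
    obtain ⟨f, hf⟩ := hx.2 i₀
    exact ⟨f, fun j => (by linarith [hf j, hεanti n.le_succ])⟩⟩
  have hK : IsCompact {x | ∀ i, s i x ≤ M} := isCompact_setOf_forall_le hs hinj M
  have hAc : ∀ n, IsClosed (A n) := by
    intro n
    refine hK.isClosed.inter ?_
    simp only [Set.ofPred_forall, Set.ofPred_exists]
    refine isClosed_iInter fun i₀ => isClosed_iUnion_of_finite fun f => isClosed_iInter fun j => ?_
    exact isClosed_le continuous_const (continuous_measureReal_vadd (hμ j) (C (f.1 j)).convex
      (hC.isConvexPartition.isClosed _))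
  obtain ⟨x, hx⟩ := IsCompact.nonempty_iInter_of_sequence_nonempty_isCompact_isClosed A hAanti hA
    (hK.of_isClosed_subset (hAc 0) Set.inter_subset_left) hAc
  rw [Set.mem_iInter] at hx
  refine ⟨x, fun i₀ => ?_⟩
  obtain ⟨f, hf⟩ := exists_forall_of_antitone (F := F i₀)
    (P := fun n f => ∀ j, α (f.1 j) - ε n ≤ (μ j).real (x +ᵥ (C (f.1 j) : Set E)))
    (fun f m n hmn h j => by linarith [h j, hεanti hmn]) fun n => (hx n).2 i₀
  refine ⟨f.1, f.2, fun j => ?_⟩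
  have hlim : Filter.Tendsto (fun n => α (f.1 j) - ε n) Filter.atTop (nhds (α (f.1 j) - 0)) :=
    tendsto_const_nhds.sub (by
      simpa [ε, div_eq_mul_inv] using
        (tendsto_one_div_add_atTop_nhds_zero_nat (𝕜 := ℝ)).const_mul δ)
  rw [sub_zero] at hlim
  exact le_of_tendsto' hlim fun n => hf n j

end Translation

theorem mainTheorem6 (d : ℕ)
    (C : Fin (d + 1) → ConvexCone ℝ (EuclideanSpace ℝ (Fin d)))
    (hC : IsConicalPartition C)
    (α : Fin (d + 1) → ℝ) (hα : ∀ i, 0 < α i) (hα_sum : ∑ i, α i = 1)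
    (μ : Fin d → Measure (EuclideanSpace ℝ (Fin d)))
    (hμ_prob : ∀ j, IsProbabilityMeasure (μ j)) (hμ_ac : ∀ j, μ j ≪ volume) :
    ∃ x : EuclideanSpace ℝ (Fin d),
      ∀ ν : Measure (EuclideanSpace ℝ (Fin d)), IsProbabilityMeasure ν → ν ≪ volume →
        ∃ π : Equiv.Perm (Fin (d + 1)), ∀ i : Fin (d + 1),
          α i ≤ (Fin.snoc (α := fun _ => Measure (EuclideanSpace ℝ (Fin d))) μ ν (π i)).real
            (x +ᵥ (C i : Set (EuclideanSpace ℝ (Fin d)))) := by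
  obtain ⟨x, hx⟩ := exists_translation hC (by simp) (by simp) hα hα_sum hμ_ac
  refine ⟨x, fun ν hν _ => ?_⟩
  obtain ⟨i₀, hi₀⟩ := exists_le_measureReal_vadd hC.isConvexPartition.iUnion_eq hα_sum ν x
  obtain ⟨f, ⟨hf, hfi⟩, hfx⟩ := hx i₀
  obtain ⟨σ, hσ, hσl⟩ := exists_perm_snoc hf hfi
  refine ⟨σ.symm, fun i => ?_⟩
  obtain ⟨k, rfl⟩ := σ.surjective i
  rw [Equiv.symm_apply_apply]
  induction k using Fin.lastCases with
  | last => rwa [Fin.snoc_last, hσl]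
  | cast j => rw [Fin.snoc_castSucc, hσ]; exact hfx j
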